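/- The domination game on a finite graph $G$ is played by Dominator and Staller, who alternately choose vertices of $G$; each chosen vertex must dominate (be equal or adjacent to) at least one vertex not dominated by the vertices chosen before. The game ends when all vertices are dominated. Dominator wants the total number of moves to be as small as possible, Staller as large as possible. The game domination number $\gamma_g(G)$ is the number of moves when Dominator moves first and both play optimally. For an edge $e$ of $G$, let $G-e$ be $G$ with $e$ removed (all vertices are kept). **Proposition.** For every integer $\ell\ge 3$ there is a connected finite graph $G$ with an edge $e$ such that $\gamma_g(G)=\ell$ and $\gamma_g(G-e)=\ell-1$. More precisely: 1. ($\ell=3$) Let $G$ be obtained from the disjoint union of two complete graphs, each of order at least three, by adding two disjoint edges between them, and let $e$ be either of the two added edges. Then $G$ is connected, $\gamma_g(G)=3$ and $\gamma_g(G-e)=2$. 2. ($\ell=k+4\ge 4$) For $k\ge 0$ let $Y_k$ be the following graph. Take a five-cycle $t,x,u,v,x'$ (so $x$ and $x'$ are the neighbours of $t$ on it), add a vertex $y$ adjacent to $x$ and $x'$, attach two leaves to $x$ and one leaf to $t$, and attach at $x$ further $k$ paths on three vertices by identifying one end vertex of each with $x$. Let $e=x'y$. Then $Y_k$ is connected,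 $\gamma_g(Y_k)=k+4$ and $\gamma_g(Y_k-e)=k+3$. -/

import Mathlib

namespace DominationGame

section Game

variable {V : Type*} [Fintype V]

open Classical in
/-- The closed neighbourhood `N[v]`: the vertices dominated by `v`. -/
noncomputable def closedNbhd (G : SimpleGraph V) (v : V) : Finset V :=
  Finset.univ.filter fun u => u = v ∨ G.Adj v u

open Classical in
/-- The vertices that may be played when `D` is the set of vertices dominated so far:
those that dominate at least one vertex outside `D`. -/
noncomputable def legalMoves (G : SimpleGraph V) (D : Finset V) : Finset V :=
  Finset.univ.filter fun v => ¬ closedNbhd G v ⊆ D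

/-- There is a legal move exactly as long as some vertex is undominated. -/
theorem legalMoves_nonempty_iff (G : SimpleGraph V) (D : Finset V) :
    (legalMoves G D).Nonempty ↔ D ≠ Finset.univ := by
  classical
  constructor
  · rintro ⟨v, hv⟩ rfl
    simp [legalMoves] at hv
  · intro h
    obtain ⟨v, hv⟩ : ∃ v, v ∉ D := by
      by_contra! hc
      exact h (Finset.eq_univ_iff_forall.2 hc)
    refine ⟨v, ?_⟩
    simp only [legalMoves, Finset.mem_filter, Finset.mem_univ, true_and]
    exact fun hs => hv (hs (by simp [closedNbhd]))

open Classical in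
/-- A legal move strictly decreases the number of undominated vertices. -/
theorem card_compl_union_lt (G : SimpleGraph V) (D : Finset V) {v : V}
    (hv : v ∈ legalMoves G D) :
    (D ∪ closedNbhd G v)ᶜ.card < Dᶜ.card := by
  apply Finset.card_lt_card
  rw [Finset.compl_ssubset_compl]
  refine ⟨Finset.subset_union_left, fun h => ?_⟩
  simp only [legalMoves, Finset.mem_filter, Finset.mem_univ, true_and] at hv
  exact hv (Finset.subset_union_right.trans h)

/-- The two players. -/
inductive Player where
  | dominator
  | staller

open Classical in
/-- The number of moves still to be played, under optimal play, when `D` is the set of vertices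
dominated so far and the given player moves next. Dominator minimizes and Staller maximizes the
number of moves; the game ends when every vertex is dominated. -/
noncomputable def movesLeft (G : SimpleGraph V) (p : Player) (D : Finset V) : ℕ :=
  if h : D = Finset.univ then 0
  else
    have hne : (legalMoves G D).attach.Nonempty :=
      Finset.attach_nonempty_iff.2 ((legalMoves_nonempty_iff G D).2 h)
    match p with
    | .dominator =>
        1 + (legalMoves G D).attach.inf' hne
          fun v => movesLeft G .staller (D ∪ closedNbhd G v.1)
    | .staller =>
        1 + (legalMoves G D).attach.sup' hne
          fun v => movesLeft G .dominator (D ∪ closedNbhd G v.1)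
termination_by Dᶜ.card
decreasing_by
  all_goals exact card_compl_union_lt G D v.2

/-- The game domination number `γ_g(G)`: the number of moves, under optimal play, of the
domination game on `G` in which Dominator moves first and no vertex is dominated initially. -/
noncomputable def gameDominationNumber (G : SimpleGraph V) : ℕ :=
  movesLeft G .dominator ∅

end Game

/-- The disjoint union of the complete graphs on `A` and `B`, together with the two edges
`a₁b₁` and `a₂b₂`. -/
def twoCliques {A B : Type*} (a₁ a₂ : A) (b₁ b₂ : B) : SimpleGraph (A ⊕ B) :=
  (SimpleGraph.completeGraph A ⊕g SimpleGraph.completeGraph B) ⊔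
    SimpleGraph.fromEdgeSet {s(Sum.inl a₁, Sum.inr b₁), s(Sum.inl a₂, Sum.inr b₂)}

/-- The vertices of `Y_k`: the five-cycle `t, x, u, v, x'`, the vertex `y`, two leaves at `x`,
a leaf at `t`, and the two further vertices `p i`, `q i` of the `i`-th path attached at `x`. -/
inductive YVertex (k : ℕ) where
  | t
  | x
  | u
  | v
  | x'
  | y
  | xLeaf₁
  | xLeaf₂
  | tLeaf
  | p (i : Fin k)
  | q (i : Fin k)
deriving DecidableEq, Fintype

open YVertex in
/-- The graph `Y_k`: a five-cycle `t x u v x'`, a vertex `y` adjacent to `x` and `x'`,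
two leaves attached to `x`, one leaf attached to `t`, and `k` paths `x, p i, q i`. -/
def graphY (k : ℕ) : SimpleGraph (YVertex k) :=
  SimpleGraph.fromEdgeSet
    ({s(t, x), s(x, u), s(u, v), s(v, x'), s(x', t),
      s(y, x), s(y, x'),
      s(x, xLeaf₁), s(x, xLeaf₂), s(t, tLeaf)} ∪
      {e | ∃ i, e = s(x, p i) ∨ e = s(p i, q i)})

end DominationGame

namespace DominationGame

/-! ### Bounds on the length of a domination game. -/

section General

variable {V : Type*} [Fintype V]

/-! Removing `e` helps Dominator because it takes away a Staller move that would waste a turn. Two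
counts carry the estimates: a game lasts at most as many moves as there are undominated vertices
(`movesLeft_le_card`), and at least as many as the size of an undominated set no two elements of
which have a common dominator (`card_le_movesLeft`).

In `Y_k` Dominator opens with `x`, leaving `v`, `x'`, `tLeaf` and the `k` path ends. With `e`
present, Staller answers `y`, which newly dominates only `x'`; the other `k + 2` vertices then cost
one move each. Other openings fare no better, because of the two leaves at `x`. Without `e`, the
move `y` gains nothing, and some move covers `x'` together with `v` or `tLeaf`, which saves one move
(`movesLeft_staller_le_of_two`).

For two cliques, the wasted move is a second move in the clique where Dominator opened, legal only
because of an added edge. -/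

theorem mem_closedNbhd {G : SimpleGraph V} {u v : V} :
    u ∈ closedNbhd G v ↔ u = v ∨ G.Adj v u := by
  simp [closedNbhd]

theorem mem_closedNbhd_deleteEdges {G : SimpleGraph V} {s : Set (Sym2 V)} {u v : V} :
    u ∈ closedNbhd (G.deleteEdges s) v ↔ u = v ∨ u ∈ closedNbhd G v ∧ s(v, u) ∉ s := by
  simp only [mem_closedNbhd, SimpleGraph.deleteEdges_adj]
  tauto

theorem mem_legalMoves {G : SimpleGraph V} {D : Finset V} {v : V} :
    v ∈ legalMoves G D ↔ ∃ u ∈ closedNbhd G v, u ∉ D := by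
  simp [legalMoves, Finset.not_subset]

theorem movesLeft_univ (G : SimpleGraph V) (p : Player) :
    movesLeft G p Finset.univ = 0 := by
  rw [movesLeft, dif_pos rfl]

theorem movesLeft_dominator_le [DecidableEq V] {G : SimpleGraph V} {D : Finset V} {v : V} {n : ℕ}
    (hv : v ∈ legalMoves G D) (h : movesLeft G .staller (D ∪ closedNbhd G v) ≤ n) :
    movesLeft G .dominator D ≤ n + 1 := by
  -- The unions inside `movesLeft` use classical decidable equality, with which any given instance
  -- agrees.
  obtain rfl : ‹DecidableEq V› = fun a b => Classical.propDecidable (a = b) :=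
    Subsingleton.elim _ _
  classical
  have hD : D ≠ Finset.univ := (legalMoves_nonempty_iff G D).1 ⟨v, hv⟩
  rw [movesLeft, dif_neg hD, add_comm n]
  exact Nat.add_le_add_left ((Finset.inf'_le
    (f := fun v : {v // v ∈ legalMoves G D} => movesLeft G .staller (D ∪ closedNbhd G v.1))
    (Finset.mem_attach _ ⟨v, hv⟩)).trans h) 1

theorem le_movesLeft_staller [DecidableEq V] {G : SimpleGraph V} {D : Finset V} {v : V} {n : ℕ}
    (hv : v ∈ legalMoves G D) (h : n ≤ movesLeft G .dominator (D ∪ closedNbhd G v)) :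
    n + 1 ≤ movesLeft G .staller D := by
  obtain rfl : ‹DecidableEq V› = fun a b => Classical.propDecidable (a = b) :=
    Subsingleton.elim _ _
  classical
  have hD : D ≠ Finset.univ := (legalMoves_nonempty_iff G D).1 ⟨v, hv⟩
  rw [movesLeft, dif_neg hD, add_comm n]
  exact Nat.add_le_add_left (h.trans (Finset.le_sup'
    (f := fun v : {v // v ∈ legalMoves G D} => movesLeft G .dominator (D ∪ closedNbhd G v.1))
    (Finset.mem_attach _ ⟨v, hv⟩))) 1

theorem movesLeft_staller_le [DecidableEq V] {G : SimpleGraph V} {D : Finset V} {n : ℕ}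
    (h : ∀ v ∈ legalMoves G D, movesLeft G .dominator (D ∪ closedNbhd G v) ≤ n) :
    movesLeft G .staller D ≤ n + 1 := by
  obtain rfl : ‹DecidableEq V› = fun a b => Classical.propDecidable (a = b) :=
    Subsingleton.elim _ _
  by_cases hD : D = Finset.univ
  · simp [hD, movesLeft_univ]
  rw [movesLeft, dif_neg hD, add_comm n]
  refine Nat.add_le_add_left (Finset.sup'_le _ _ ?_) 1
  exact fun v _ => h v.1 v.2

theorem le_movesLeft_dominator [DecidableEq V] {G : SimpleGraph V} {D : Finset V} {n : ℕ}
    (hD : D ≠ Finset.univ)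
    (h : ∀ v ∈ legalMoves G D, n ≤ movesLeft G .staller (D ∪ closedNbhd G v)) :
    n + 1 ≤ movesLeft G .dominator D := by
  obtain rfl : ‹DecidableEq V› = fun a b => Classical.propDecidable (a = b) :=
    Subsingleton.elim _ _
  rw [movesLeft, dif_neg hD, add_comm n]
  refine Nat.add_le_add_left (Finset.le_inf' _ _ ?_) 1
  exact fun v _ => h v.1 v.2

theorem card_compl_union_closedNbhd_lt [DecidableEq V] {G : SimpleGraph V} {D : Finset V} {v : V}
    (hv : v ∈ legalMoves G D) : (D ∪ closedNbhd G v)ᶜ.card < Dᶜ.card := by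
  obtain rfl : ‹DecidableEq V› = fun a b => Classical.propDecidable (a = b) :=
    Subsingleton.elim _ _
  exact card_compl_union_lt G D hv

/-- Every move dominates a new vertex, so the game lasts at most as many moves as there are
undominated vertices. -/
theorem movesLeft_le_card [DecidableEq V] {G : SimpleGraph V} (n : ℕ) :
    ∀ (p : Player) (D : Finset V), Dᶜ.card ≤ n → movesLeft G p D ≤ n := by
  induction n with
  | zero =>
    intro p D h
    have hD : D = Finset.univ := by simpa using h
    simp [hD, movesLeft_univ]
  | succ n ih =>
    intro p D h
    have step : ∀ v ∈ legalMoves G D, (D ∪ closedNbhd G v)ᶜ.card ≤ n := fun v hv => by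
      have := card_compl_union_closedNbhd_lt hv
      omega
    cases p with
    | staller => exact movesLeft_staller_le fun v hv => ih _ _ (step v hv)
    | dominator =>
      by_cases hD : D = Finset.univ
      · simp [hD, movesLeft_univ]
      obtain ⟨v, hv⟩ := (legalMoves_nonempty_iff G D).2 hD
      exact movesLeft_dominator_le hv (ih _ _ (step v hv))

theorem movesLeft_le_of_forall_mem {G : SimpleGraph V} {p : Player} {D S : Finset V} {n : ℕ}
    (hS : ∀ u, u ∉ D → u ∈ S) (hn : S.card ≤ n) : movesLeft G p D ≤ n := by
  classical
  exact movesLeft_le_card n p D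
    ((Finset.card_le_card fun u hu => hS u (by simpa using hu)).trans hn)

/-- If one vertex dominates all that is left, Dominator can finish at once. -/
theorem movesLeft_dominator_le_one {G : SimpleGraph V} {D : Finset V} (v : V)
    (h : ∀ u, u ∉ D → u ∈ closedNbhd G v) : movesLeft G .dominator D ≤ 1 := by
  classical
  by_cases hD : D = Finset.univ
  · simp [hD, movesLeft_univ]
  obtain ⟨u, hu⟩ : ∃ u, u ∉ D := by
    by_contra! hc
    exact hD (Finset.eq_univ_iff_forall.2 hc)
  refine movesLeft_dominator_le (mem_legalMoves.2 ⟨u, h u hu, hu⟩) ?_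
  refine movesLeft_le_of_forall_mem (S := ∅) (fun w hw => ?_) le_rfl
  simp only [Finset.mem_union, not_or] at hw
  exact absurd (h w hw.1) hw.2

/-- If no vertex dominates two elements of a set of undominated vertices, then the game lasts at
least as many moves as this set has elements. -/
theorem card_le_movesLeft {G : SimpleGraph V} (n : ℕ) :
    ∀ (p : Player) (D P : Finset V), P.card = n → (∀ a ∈ P, a ∉ D) →
      (∀ w, ∀ a ∈ P, ∀ b ∈ P, a ∈ closedNbhd G w → b ∈ closedNbhd G w → a = b) →
      n ≤ movesLeft G p D := by
  classical
  induction n with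
  | zero => intros; exact Nat.zero_le _
  | succ n ih =>
    intro p D P hn hPD hP
    have step : ∀ p w, n ≤ movesLeft G p (D ∪ closedNbhd G w) := by
      intro p w
      -- The element `a` to be given up: the one dominated by `w`, or an arbitrary one if there is
      -- none.
      obtain ⟨a, haP, ha⟩ : ∃ a ∈ P, ∀ b ∈ P, b ∈ closedNbhd G w → b = a := by
        by_cases h : ∃ a ∈ P, a ∈ closedNbhd G w
        · obtain ⟨a, haP, haw⟩ := h
          exact ⟨a, haP, fun b hb hbw => hP w b hb a haP hbw haw⟩
        · obtain ⟨a, haP⟩ : P.Nonempty := Finset.card_pos.1 (by omega)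
          exact ⟨a, haP, fun b hb hbw => (h ⟨b, hb, hbw⟩).elim⟩
      refine ih p _ (P.erase a) (by rw [Finset.card_erase_of_mem haP]; omega) ?_ ?_
      · intro b hb hbD
        rw [Finset.mem_erase] at hb
        rcases Finset.mem_union.1 hbD with h | h
        · exact hPD b hb.2 h
        · exact hb.1 (ha b hb.2 h)
      · exact fun v b hb c hc =>
          hP v b (Finset.mem_of_mem_erase hb) c (Finset.mem_of_mem_erase hc)
    obtain ⟨a, haP⟩ : P.Nonempty := Finset.card_pos.1 (by omega)
    have hD : D ≠ Finset.univ := fun h => hPD a haP (h ▸ Finset.mem_univ a)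
    cases p with
    | dominator => exact le_movesLeft_dominator hD fun v _ => step _ v
    | staller =>
      obtain ⟨v, hv⟩ := (legalMoves_nonempty_iff G D).2 hD
      exact le_movesLeft_staller hv (step _ v)

theorem one_le_movesLeft {G : SimpleGraph V} {p : Player} {D : Finset V} (a : V) (ha : a ∉ D) :
    1 ≤ movesLeft G p D :=
  card_le_movesLeft 1 p D {a} (by simp) (by simpa using ha) (by simp)

/-- A move that dominates two undominated vertices leaves two fewer. -/
theorem card_compl_union_add_two_le [DecidableEq V] {G : SimpleGraph V} {D : Finset V}
    {w a b : V} (hab : a ≠ b) (ha : a ∈ closedNbhd G w) (hb : b ∈ closedNbhd G w)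
    (haD : a ∉ D) (hbD : b ∉ D) : (D ∪ closedNbhd G w)ᶜ.card + 2 ≤ Dᶜ.card := by
  rw [← Finset.card_pair hab, ← Finset.card_union_of_disjoint]
  · refine Finset.card_le_card fun c hc => ?_
    simp only [Finset.mem_union, Finset.mem_insert, Finset.mem_singleton,
      Finset.mem_compl] at hc ⊢
    rcases hc with hc | rfl | rfl
    · exact fun h => hc (.inl h)
    · exact haD
    · exact hbD
  · rw [Finset.disjoint_left]
    rintro c hc h
    simp only [Finset.mem_union, Finset.mem_insert, Finset.mem_singleton,
      Finset.mem_compl] at hc h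
    rcases h with rfl | rfl
    · exact hc (.inr ha)
    · exact hc (.inr hb)

/-- If a legal move of Staller dominates two new vertices, or Dominator has a reply that does, then
at least one undominated vertex is not paid for by a move of its own. -/
theorem movesLeft_staller_le_of_two [DecidableEq V] {G : SimpleGraph V} {D : Finset V}
    {n : ℕ} (hn : Dᶜ.card ≤ n + 1)
    (h : ∀ w ∈ legalMoves G D,
      (∃ a b, a ≠ b ∧ a ∈ closedNbhd G w ∧ b ∈ closedNbhd G w ∧ a ∉ D ∧ b ∉ D) ∨
      ∃ z a b, a ≠ b ∧ a ∈ closedNbhd G z ∧ b ∈ closedNbhd G z ∧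
        a ∉ D ∪ closedNbhd G w ∧ b ∉ D ∪ closedNbhd G w) :
    movesLeft G .staller D ≤ n := by
  by_cases hD : D = Finset.univ
  · simp [hD, movesLeft_univ]
  -- Both alternatives exhibit at least two undominated vertices in `D`, so `n + 1` is at least two.
  have hpos : 1 ≤ n := by
    obtain ⟨w, hw⟩ := (legalMoves_nonempty_iff G D).2 hD
    rcases h w hw with ⟨a, b, hab, ha, hb, haD, hbD⟩ | ⟨z, a, b, hab, ha, hb, haD, hbD⟩
    · have := card_compl_union_add_two_le hab ha hb haD hbD
      omega
    · have := card_compl_union_add_two_le hab ha hb haD hbD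
      have := card_compl_union_closedNbhd_lt hw
      omega
  obtain ⟨n, rfl⟩ := Nat.exists_eq_add_of_le' hpos
  refine movesLeft_staller_le fun w hw => ?_
  rcases h w hw with ⟨a, b, hab, ha, hb, haD, hbD⟩ | ⟨z, a, b, hab, ha, hb, haD, hbD⟩
  · have := card_compl_union_add_two_le hab ha hb haD hbD
    exact movesLeft_le_card n _ _ (by omega)
  · have h₁ := card_compl_union_add_two_le hab ha hb haD hbD
    have h₂ := card_compl_union_closedNbhd_lt hw
    obtain ⟨m, rfl⟩ : ∃ m, n = m + 1 := Nat.exists_eq_add_of_le' (by omega)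
    exact movesLeft_dominator_le (mem_legalMoves.2 ⟨a, ha, haD⟩)
      (movesLeft_le_card m _ _ (by omega))

end General

/-! ### Two cliques joined by two edges. -/

section TwoCliques

variable {A B : Type*} {a₁ a₂ : A} {b₁ b₂ : B}

@[simp] theorem twoCliques_adj_inl_inl {a a' : A} :
    (twoCliques a₁ a₂ b₁ b₂).Adj (Sum.inl a) (Sum.inl a') ↔ a ≠ a' := by
  simp [twoCliques]

@[simp] theorem twoCliques_adj_inr_inr {b b' : B} :
    (twoCliques a₁ a₂ b₁ b₂).Adj (Sum.inr b) (Sum.inr b') ↔ b ≠ b' := by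
  simp [twoCliques]

@[simp] theorem twoCliques_adj_inl_inr {a : A} {b : B} :
    (twoCliques a₁ a₂ b₁ b₂).Adj (Sum.inl a) (Sum.inr b) ↔
      a = a₁ ∧ b = b₁ ∨ a = a₂ ∧ b = b₂ := by
  simp [twoCliques]

@[simp] theorem twoCliques_adj_inr_inl {a : A} {b : B} :
    (twoCliques a₁ a₂ b₁ b₂).Adj (Sum.inr b) (Sum.inl a) ↔
      a = a₁ ∧ b = b₁ ∨ a = a₂ ∧ b = b₂ := by
  rw [SimpleGraph.adj_comm, twoCliques_adj_inl_inr]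

theorem twoCliques_swap : twoCliques a₁ a₂ b₁ b₂ = twoCliques a₂ a₁ b₂ b₁ := by
  rw [twoCliques, twoCliques, Set.pair_comm]

theorem twoCliques_connected : (twoCliques a₁ a₂ b₁ b₂).Connected := by
  rw [SimpleGraph.connected_iff_exists_forall_reachable]
  refine ⟨Sum.inl a₁, ?_⟩
  have hab : (twoCliques a₁ a₂ b₁ b₂).Reachable (Sum.inl a₁) (Sum.inr b₁) :=
    SimpleGraph.Adj.reachable (by simp)
  rintro (a | b)
  · by_cases h : a₁ = a
    · rw [h]
    · exact SimpleGraph.Adj.reachable (by simpa using h)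
  · by_cases h : b₁ = b
    · rwa [← h]
    · exact hab.trans (SimpleGraph.Adj.reachable (by simpa using h))

variable [Fintype A] [Fintype B]

theorem exists_ne_ne {A : Type*} [Fintype A] (h : 3 ≤ Fintype.card A) (a b : A) :
    ∃ c, c ≠ a ∧ c ≠ b := by
  classical
  obtain ⟨c, hc⟩ : ∃ c, c ∉ ({a, b} : Finset A) := by
    by_contra! hc
    have := Finset.card_le_two (a := a) (b := b)
    rw [Finset.eq_univ_iff_forall.2 hc, Finset.card_univ] at this
    omega
  exact ⟨c, by simpa using hc⟩

/-- For the upper bound, Dominator plays `a₁` and later `b₁`. For the lower bound, Staller replies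
in the same clique at an end of an added edge, gaining only the other end; a third vertex of the
opposite clique stays undominated. -/
theorem gameDominationNumber_twoCliques (hA : 3 ≤ Fintype.card A) (hB : 3 ≤ Fintype.card B)
    (ha : a₁ ≠ a₂) (hb : b₁ ≠ b₂) :
    gameDominationNumber (twoCliques a₁ a₂ b₁ b₂) = 3 := by
  classical
  obtain ⟨a₃, ha₁, ha₂⟩ := exists_ne_ne hA a₁ a₂
  obtain ⟨b₃, hb₁, hb₂⟩ := exists_ne_ne hB b₁ b₂
  apply le_antisymm
  · refine movesLeft_dominator_le (v := Sum.inl a₁)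
      (mem_legalMoves.2 ⟨Sum.inl a₁, by simp [mem_closedNbhd], by simp⟩) ?_
    refine movesLeft_staller_le fun v _ => movesLeft_dominator_le_one (Sum.inr b₁) ?_
    rintro (a | b)
    · simp +contextual [mem_closedNbhd, em, eq_comm]
    · simp [mem_closedNbhd, eq_comm, em]
  · refine le_movesLeft_dominator (fun h => by
      simpa using Finset.eq_univ_iff_forall.1 h (Sum.inl a₁)) fun v _ => ?_
    rcases v with a | b
    · by_cases h : a = a₁
      · refine le_movesLeft_staller (v := Sum.inl a₂) (mem_legalMoves.2
          ⟨Sum.inr b₂, by simp [mem_closedNbhd], by simp [mem_closedNbhd, h, ha, hb.symm]⟩) ?_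
        exact one_le_movesLeft (Sum.inr b₃) (by simp [mem_closedNbhd, hb₁, hb₂])
      · refine le_movesLeft_staller (v := Sum.inl a₁) (mem_legalMoves.2
          ⟨Sum.inr b₁, by simp [mem_closedNbhd], by simp [mem_closedNbhd, h, hb]⟩) ?_
        exact one_le_movesLeft (Sum.inr b₃) (by simp [mem_closedNbhd, hb₁, hb₂])
    · by_cases h : b = b₁
      · refine le_movesLeft_staller (v := Sum.inr b₂) (mem_legalMoves.2
          ⟨Sum.inl a₂, by simp [mem_closedNbhd], by simp [mem_closedNbhd, h, hb, ha.symm]⟩) ?_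
        exact one_le_movesLeft (Sum.inl a₃) (by simp [mem_closedNbhd, ha₁, ha₂])
      · refine le_movesLeft_staller (v := Sum.inr b₁) (mem_legalMoves.2
          ⟨Sum.inl a₁, by simp [mem_closedNbhd], by simp [mem_closedNbhd, h, ha]⟩) ?_
        exact one_le_movesLeft (Sum.inl a₃) (by simp [mem_closedNbhd, ha₁, ha₂])

/-- After Dominator's move `a₂`, no vertex of `A` dominates anything new, so Staller must play in
`B` and thereby finishes the game. Conversely, `a₃` and `b₃` have no common dominator. -/
theorem gameDominationNumber_twoCliques_deleteEdges
    (hA : 3 ≤ Fintype.card A) (hB : 3 ≤ Fintype.card B) (ha : a₁ ≠ a₂) :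
    gameDominationNumber
      ((twoCliques a₁ a₂ b₁ b₂).deleteEdges {s(Sum.inl a₁, Sum.inr b₁)}) = 2 := by
  classical
  obtain ⟨a₃, ha₁, ha₂⟩ := exists_ne_ne hA a₁ a₂
  obtain ⟨b₃, hb₁, hb₂⟩ := exists_ne_ne hB b₁ b₂
  apply le_antisymm
  · refine movesLeft_dominator_le (v := Sum.inl a₂)
      (mem_legalMoves.2 ⟨Sum.inl a₂, by simp [mem_closedNbhd], by simp⟩) ?_
    refine movesLeft_staller_le fun v hv => movesLeft_le_of_forall_mem (S := ∅) ?_ le_rfl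
    obtain ⟨u, hu, huD⟩ := mem_legalMoves.1 hv
    rintro (a | b) hw
    · simp [mem_closedNbhd, eq_comm, em] at hw
    · rcases v with a | b'
      · rcases u with a' | b'
        · simp [mem_closedNbhd, eq_comm, em] at huD
        · simp [mem_closedNbhd] at hu huD
          grind
      · simp [mem_closedNbhd] at hw
        grind
  · refine card_le_movesLeft 2 _ _ {Sum.inl a₃, Sum.inr b₃} (by simp) (by simp) ?_
    rintro (a | b) <;> simp [mem_closedNbhd, ha₁, ha₂, hb₁, hb₂]

end TwoCliques

/-! ### The graphs `Y_k`. -/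

section GraphY

set_option linter.unusedSimpArgs false

variable {k : ℕ}

open YVertex

theorem graphY_connected : (graphY k).Connected := by
  rw [SimpleGraph.connected_iff_exists_forall_reachable]
  refine ⟨x, ?_⟩
  have ht : (graphY k).Reachable x t := SimpleGraph.Adj.reachable (by simp [graphY])
  have hu : (graphY k).Reachable x u := SimpleGraph.Adj.reachable (by simp [graphY])
  have hp : ∀ i, (graphY k).Reachable x (p i) :=
    fun i => SimpleGraph.Adj.reachable (by simp [graphY])
  intro w
  cases w with
  | t => exact ht
  | x => rfl
  | u => exact hu
  | v => exact hu.trans (SimpleGraph.Adj.reachable (by simp [graphY]))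
  | x' => exact ht.trans (SimpleGraph.Adj.reachable (by simp [graphY]))
  | y => exact SimpleGraph.Adj.reachable (by simp [graphY])
  | xLeaf₁ => exact SimpleGraph.Adj.reachable (by simp [graphY])
  | xLeaf₂ => exact SimpleGraph.Adj.reachable (by simp [graphY])
  | tLeaf => exact ht.trans (SimpleGraph.Adj.reachable (by simp [graphY]))
  | p i => exact hp i
  | q i => exact (hp i).trans (SimpleGraph.Adj.reachable (by simp [graphY]))

theorem graphY_adj {a b : YVertex k} : (graphY k).Adj a b ↔
    (s(a, b) = s(t, x) ∨ s(a, b) = s(x, u) ∨ s(a, b) = s(u, v) ∨ s(a, b) = s(v, x') ∨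
      s(a, b) = s(x', t) ∨ s(a, b) = s(y, x) ∨ s(a, b) = s(y, x') ∨ s(a, b) = s(x, xLeaf₁) ∨
      s(a, b) = s(x, xLeaf₂) ∨ s(a, b) = s(t, tLeaf) ∨
      ∃ i, s(a, b) = s(x, p i) ∨ s(a, b) = s(p i, q i)) ∧ a ≠ b := by
  simp only [graphY, SimpleGraph.fromEdgeSet_adj, Set.mem_union, Set.mem_insert_iff,
    Set.mem_singleton_iff, Set.mem_ofPred_eq, or_assoc]

@[simp] theorem mem_closedNbhd_t {a : YVertex k} :
    a ∈ closedNbhd (graphY k) t ↔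
      a = t ∨ a = x ∨ a = x' ∨ a = tLeaf := by
  simp only [mem_closedNbhd, graphY_adj, Sym2.eq_iff, reduceCtorEq, true_and, false_and, and_false,
    or_false, false_or, exists_false]
  grind

@[simp] theorem mem_closedNbhd_x {a : YVertex k} :
    a ∈ closedNbhd (graphY k) x ↔
      a = x ∨ a = t ∨ a = u ∨ a = y ∨ a = xLeaf₁ ∨ a = xLeaf₂ ∨ ∃ i, a = p i := by
  simp only [mem_closedNbhd, graphY_adj, Sym2.eq_iff, reduceCtorEq, true_and, false_and, and_false,
    or_false, false_or, exists_false]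
  grind

@[simp] theorem mem_closedNbhd_u {a : YVertex k} :
    a ∈ closedNbhd (graphY k) u ↔
      a = u ∨ a = x ∨ a = v := by
  simp only [mem_closedNbhd, graphY_adj, Sym2.eq_iff, reduceCtorEq, true_and, false_and, and_false,
    or_false, false_or, exists_false]
  grind

@[simp] theorem mem_closedNbhd_v {a : YVertex k} :
    a ∈ closedNbhd (graphY k) v ↔
      a = v ∨ a = u ∨ a = x' := by
  simp only [mem_closedNbhd, graphY_adj, Sym2.eq_iff, reduceCtorEq, true_and, false_and, and_false,
    or_false, false_or, exists_false]
  grind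

@[simp] theorem mem_closedNbhd_x' {a : YVertex k} :
    a ∈ closedNbhd (graphY k) x' ↔
      a = x' ∨ a = v ∨ a = t ∨ a = y := by
  simp only [mem_closedNbhd, graphY_adj, Sym2.eq_iff, reduceCtorEq, true_and, false_and, and_false,
    or_false, false_or, exists_false]
  grind

@[simp] theorem mem_closedNbhd_y {a : YVertex k} :
    a ∈ closedNbhd (graphY k) y ↔
      a = y ∨ a = x ∨ a = x' := by
  simp only [mem_closedNbhd, graphY_adj, Sym2.eq_iff, reduceCtorEq, true_and, false_and, and_false,
    or_false, false_or, exists_false]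
  grind

@[simp] theorem mem_closedNbhd_xLeaf₁ {a : YVertex k} :
    a ∈ closedNbhd (graphY k) xLeaf₁ ↔
      a = xLeaf₁ ∨ a = x := by
  simp only [mem_closedNbhd, graphY_adj, Sym2.eq_iff, reduceCtorEq, true_and, false_and, and_false,
    or_false, false_or, exists_false]
  grind

@[simp] theorem mem_closedNbhd_xLeaf₂ {a : YVertex k} :
    a ∈ closedNbhd (graphY k) xLeaf₂ ↔
      a = xLeaf₂ ∨ a = x := by
  simp only [mem_closedNbhd, graphY_adj, Sym2.eq_iff, reduceCtorEq, true_and, false_and, and_false,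
    or_false, false_or, exists_false]
  grind

@[simp] theorem mem_closedNbhd_tLeaf {a : YVertex k} :
    a ∈ closedNbhd (graphY k) tLeaf ↔
      a = tLeaf ∨ a = t := by
  simp only [mem_closedNbhd, graphY_adj, Sym2.eq_iff, reduceCtorEq, true_and, false_and, and_false,
    or_false, false_or, exists_false]
  grind

@[simp] theorem mem_closedNbhd_p {a : YVertex k} {i : Fin k} :
    a ∈ closedNbhd (graphY k) (p i) ↔
      a = p i ∨ a = x ∨ a = q i := by
  simp only [mem_closedNbhd, graphY_adj, Sym2.eq_iff, reduceCtorEq, true_and, false_and, and_false,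
    or_false, false_or, exists_false]
  grind

@[simp] theorem mem_closedNbhd_q {a : YVertex k} {i : Fin k} :
    a ∈ closedNbhd (graphY k) (q i) ↔
      a = q i ∨ a = p i := by
  simp only [mem_closedNbhd, graphY_adj, Sym2.eq_iff, reduceCtorEq, true_and, false_and, and_false,
    or_false, false_or, exists_false]
  grind

/-- The far ends of the `k` paths attached at `x`. -/
def pathEnds (k : ℕ) : Finset (YVertex k) :=
  Finset.univ.map ⟨q, fun _ _ h => by simpa using h⟩

@[simp] theorem mem_pathEnds {w : YVertex k} : w ∈ pathEnds k ↔ ∃ i, q i = w := by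
  simp only [pathEnds, Finset.mem_map, Finset.mem_univ, true_and]
  rfl

@[simp] theorem card_pathEnds : (pathEnds k).card = k := by simp [pathEnds]

theorem card_insert_pathEnds_three {a b c : YVertex k}
    (hab : a ≠ b) (hac : a ≠ c) (hbc : b ≠ c) (ha : a ∉ pathEnds k) (hb : b ∉ pathEnds k)
    (hc : c ∉ pathEnds k) : (insert a (insert b (insert c (pathEnds k)))).card = k + 3 := by
  rw [Finset.card_insert_of_notMem (by simp_all), Finset.card_insert_of_notMem (by simp_all),
    Finset.card_insert_of_notMem hc, card_pathEnds]

theorem gameDominationNumber_graphY_le : gameDominationNumber (graphY k) ≤ k + 4 := by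
  classical
  refine movesLeft_dominator_le (v := x)
    (mem_legalMoves.2 ⟨x, by simp, by simp⟩) ?_
  refine movesLeft_le_of_forall_mem (S := insert v (insert x' (insert tLeaf (pathEnds k))))
    (fun w hw => ?_)
    (card_insert_pathEnds_three (by simp) (by simp) (by simp) (by simp) (by simp) (by simp)).le
  cases w <;> simp at hw ⊢

/-- The element of the packing `a`, `tLeaf`, `v`, `q i` that a vertex can dominate, where `a` is a
leaf at `x`; the value at `y` is irrelevant. -/
def packingRep (a : YVertex k) : YVertex k → YVertex k
  | t | tLeaf => tLeaf
  | u | v | x' => v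
  | p i | q i => q i
  | _ => a

/-- The only candidate depends on `w` alone, so a case check on `w` replaces comparing pairs of
elements of the packing. -/
theorem eq_packingRep {a : YVertex k} (ha : a = xLeaf₁ ∨ a = xLeaf₂) (w b : YVertex k)
    (hb : b ∈ insert a (insert tLeaf (insert v (pathEnds k))))
    (hbw : b ∈ closedNbhd (graphY k) w) : b = packingRep a w := by
  simp only [Finset.mem_insert, mem_pathEnds] at hb
  rcases hb with rfl | rfl | rfl | ⟨i, rfl⟩
  · rcases ha with rfl | rfl <;> cases w <;> simp_all [packingRep]
  · cases w <;> simp_all [packingRep]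
  · cases w <;> simp_all [packingRep]
  · cases w <;> simp_all [packingRep]

theorem packing_graphY {a : YVertex k} (ha : a = xLeaf₁ ∨ a = xLeaf₂) (w b : YVertex k)
    (hb : b ∈ insert a (insert tLeaf (insert v (pathEnds k)))) (c : YVertex k)
    (hc : c ∈ insert a (insert tLeaf (insert v (pathEnds k))))
    (hbw : b ∈ closedNbhd (graphY k) w) (hcw : c ∈ closedNbhd (graphY k) w) : b = c :=
  (eq_packingRep ha w b hb hbw).trans (eq_packingRep ha w c hc hcw).symm

theorem card_insert_pathEnds_two :
    (insert tLeaf (insert v (pathEnds k))).card = k + 2 := by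
  rw [Finset.card_insert_of_notMem (by simp), Finset.card_insert_of_notMem (by simp),
    card_pathEnds]

/-- If Staller can answer Dominator's first move by a move after which `tLeaf`, `v` and the path
ends are undominated, the game takes at least `k + 4` moves. -/
theorem add_three_le_of_reply {D : Finset (YVertex k)} {w : YVertex k}
    (hw : w ∈ legalMoves (graphY k) D)
    (h : ∀ b ∈ insert tLeaf (insert v (pathEnds k)), b ∉ D ∪ closedNbhd (graphY k) w) :
    k + 3 ≤ movesLeft (graphY k) .staller D :=
  le_movesLeft_staller hw <| card_le_movesLeft _ _ _ _ card_insert_pathEnds_two h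
    fun w b hb c hc => packing_graphY (.inl rfl) w b (Finset.mem_insert_of_mem hb) c
      (Finset.mem_insert_of_mem hc)

/-- Staller's reply spares `k + 2` packing elements: `y` against `x`, and otherwise a leaf at `x`,
while the other leaf can serve in the packing. -/
theorem le_gameDominationNumber_graphY : k + 4 ≤ gameDominationNumber (graphY k) := by
  classical
  refine le_movesLeft_dominator (fun h => by
    simpa using Finset.eq_univ_iff_forall.1 h x) fun w _ => ?_
  rw [Finset.empty_union]
  by_cases hx : w = x
  · subst hx
    refine add_three_le_of_reply (w := y) (mem_legalMoves.2
      ⟨x', by simp, by simp⟩) ?_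
    simp
  -- This case is separate because the default reply `xLeaf₁` would be illegal.
  by_cases h₁ : w = xLeaf₁
  · subst h₁
    refine add_three_le_of_reply (w := xLeaf₂) (mem_legalMoves.2
      ⟨xLeaf₂, by simp, by simp⟩) ?_
    simp
  have hcard : (insert xLeaf₂ (insert tLeaf (insert v (pathEnds k)))).card = k + 3 :=
    card_insert_pathEnds_three (by simp) (by simp) (by simp) (by simp) (by simp) (by simp)
  refine le_movesLeft_staller (v := xLeaf₁) (mem_legalMoves.2
    ⟨xLeaf₁, by simp, by
      cases w <;> simp_all⟩) ?_
  -- The opening `w` costs at most one of the `k + 3` packing elements, namely `packingRep xLeaf₂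
  -- w`; the reply `xLeaf₁` costs none.
  refine (?_ : k + 2 ≤ ((insert xLeaf₂ (insert tLeaf (insert v (pathEnds k)))).erase
    (packingRep xLeaf₂ w)).card).trans (card_le_movesLeft _ _ _ _ rfl (fun b hb hbD => ?_)
      fun z b hb c hc => packing_graphY (.inr rfl) z b (Finset.mem_of_mem_erase hb) c
        (Finset.mem_of_mem_erase hc))
  · have := Finset.pred_card_le_card_erase
      (s := insert xLeaf₂ (insert tLeaf (insert v (pathEnds k)))) (a := packingRep xLeaf₂ w)
    omega
  · rw [Finset.mem_erase] at hb
    rcases Finset.mem_union.1 hbD with h | h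
    · exact hb.1 (eq_packingRep (.inr rfl) w b hb.2 h)
    · have := hb.2
      cases b <;> simp_all

/-- Deleting edges only shrinks closed neighbourhoods, so the packing of size `k + 3` survives. -/
theorem le_gameDominationNumber_graphY_deleteEdges (s : Set (Sym2 (YVertex k))) :
    k + 3 ≤ gameDominationNumber ((graphY k).deleteEdges s) := by
  have hle (w b : YVertex k) (h : b ∈ closedNbhd ((graphY k).deleteEdges s) w) :
      b ∈ closedNbhd (graphY k) w := by
    rw [mem_closedNbhd] at h ⊢
    exact h.imp_right fun h => SimpleGraph.deleteEdges_le s h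
  classical
  exact card_le_movesLeft _ _ _ (insert xLeaf₁ (insert tLeaf (insert v (pathEnds k))))
    (card_insert_pathEnds_three (by simp) (by simp) (by simp) (by simp) (by simp) (by simp))
    (by simp)
    fun w b hb c hc hbw hcw => packing_graphY (.inl rfl) w b hb c hc (hle w b hbw) (hle w c hcw)

/-- After the opening `x`, each of the remaining dominators `t`, `v`, `x'` of `x'` also gains
`tLeaf` or `v`. Staller therefore either makes such a double move or leaves one for Dominator. -/
theorem gameDominationNumber_graphY_deleteEdges_le :
    gameDominationNumber ((graphY k).deleteEdges {s(x', y)}) ≤ k + 3 := by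
  classical
  refine movesLeft_dominator_le (v := x)
    (mem_legalMoves.2 ⟨x, by simp [mem_closedNbhd_deleteEdges], by simp⟩) ?_
  rw [Finset.empty_union]
  apply movesLeft_staller_le_of_two
  · rw [← card_insert_pathEnds_three (k := k) (a := v) (b := x') (c := tLeaf) (by simp) (by simp)
      (by simp) (by simp) (by simp) (by simp)]
    refine Finset.card_le_card fun w hw => ?_
    rw [Finset.mem_compl] at hw
    cases w <;> simp [mem_closedNbhd_deleteEdges] at hw ⊢
  · intro w _
    by_cases hw : w = t ∨ w = v ∨ w = x'
    · left
      rcases hw with rfl | rfl | rfl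
      · exact ⟨x', tLeaf, by simp [mem_closedNbhd_deleteEdges]⟩
      · exact ⟨x', v, by simp [mem_closedNbhd_deleteEdges]⟩
      · exact ⟨x', v, by simp [mem_closedNbhd_deleteEdges]⟩
    · right
      -- The reply `t` gains both `x'` and `tLeaf` unless Staller has just taken `tLeaf`; then `v`
      -- gains `x'` and `v`.
      by_cases ht : w = tLeaf
      · exact ⟨v, x', v, by simp [mem_closedNbhd_deleteEdges, ht]⟩
      · refine ⟨t, x', tLeaf, ?_⟩
        cases w <;> simp_all [mem_closedNbhd_deleteEdges]

theorem gameDominationNumber_graphY : gameDominationNumber (graphY k) = k + 4 :=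
  gameDominationNumber_graphY_le.antisymm le_gameDominationNumber_graphY

theorem gameDominationNumber_graphY_deleteEdges :
    gameDominationNumber ((graphY k).deleteEdges {s(x', y)}) = k + 3 :=
  gameDominationNumber_graphY_deleteEdges_le.antisymm
    (le_gameDominationNumber_graphY_deleteEdges _)

end GraphY

end DominationGame

theorem mainTheorem5 :
    (∀ ℓ : ℕ, 3 ≤ ℓ →
      ∃ (V : Type) (_ : Fintype V) (G : SimpleGraph V) (e : Sym2 V),
        G.Connected ∧ e ∈ G.edgeSet ∧
        DominationGame.gameDominationNumber G = ℓ ∧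
        DominationGame.gameDominationNumber (G.deleteEdges {e}) = ℓ - 1) ∧
    (∀ (A B : Type) [Fintype A] [Fintype B] (a₁ a₂ : A) (b₁ b₂ : B),
      3 ≤ Fintype.card A → 3 ≤ Fintype.card B → a₁ ≠ a₂ → b₁ ≠ b₂ →
        (DominationGame.twoCliques a₁ a₂ b₁ b₂).Connected ∧
        DominationGame.gameDominationNumber (DominationGame.twoCliques a₁ a₂ b₁ b₂) = 3 ∧
        ∀ e : Sym2 (A ⊕ B),
          (e = s(Sum.inl a₁, Sum.inr b₁) ∨ e = s(Sum.inl a₂, Sum.inr b₂)) →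
            e ∈ (DominationGame.twoCliques a₁ a₂ b₁ b₂).edgeSet ∧
            DominationGame.gameDominationNumber
              ((DominationGame.twoCliques a₁ a₂ b₁ b₂).deleteEdges {e}) = 2) ∧
    (∀ k : ℕ,
      (DominationGame.graphY k).Connected ∧
      s(DominationGame.YVertex.x', DominationGame.YVertex.y) ∈
        (DominationGame.graphY k).edgeSet ∧
      DominationGame.gameDominationNumber (DominationGame.graphY k) = k + 4 ∧
      DominationGame.gameDominationNumber
        ((DominationGame.graphY k).deleteEdges
          {s(DominationGame.YVertex.x', DominationGame.YVertex.y)}) = k + 3) := by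
  have cliques : ∀ (A B : Type) [Fintype A] [Fintype B] (a₁ a₂ : A) (b₁ b₂ : B),
      3 ≤ Fintype.card A → 3 ≤ Fintype.card B → a₁ ≠ a₂ → b₁ ≠ b₂ →
        (DominationGame.twoCliques a₁ a₂ b₁ b₂).Connected ∧
        DominationGame.gameDominationNumber (DominationGame.twoCliques a₁ a₂ b₁ b₂) = 3 ∧
        ∀ e : Sym2 (A ⊕ B),
          (e = s(Sum.inl a₁, Sum.inr b₁) ∨ e = s(Sum.inl a₂, Sum.inr b₂)) →
            e ∈ (DominationGame.twoCliques a₁ a₂ b₁ b₂).edgeSet ∧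
            DominationGame.gameDominationNumber
              ((DominationGame.twoCliques a₁ a₂ b₁ b₂).deleteEdges {e}) = 2 := by
    intro A B _ _ a₁ a₂ b₁ b₂ hA hB ha hb
    refine ⟨DominationGame.twoCliques_connected,
      DominationGame.gameDominationNumber_twoCliques hA hB ha hb, ?_⟩
    rintro e (rfl | rfl)
    · exact ⟨by simp, DominationGame.gameDominationNumber_twoCliques_deleteEdges hA hB ha⟩
    · refine ⟨by simp, ?_⟩
      rw [DominationGame.twoCliques_swap]
      exact DominationGame.gameDominationNumber_twoCliques_deleteEdges hA hB ha.symm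
  have hY (k : ℕ) : s(DominationGame.YVertex.x', DominationGame.YVertex.y) ∈
      (DominationGame.graphY k).edgeSet := by simp [DominationGame.graphY]
  refine ⟨fun ℓ hℓ => ?_, cliques, fun k => ⟨DominationGame.graphY_connected, hY k,
    DominationGame.gameDominationNumber_graphY,
    DominationGame.gameDominationNumber_graphY_deleteEdges⟩⟩
  rcases hℓ.eq_or_lt with rfl | hℓ
  · obtain ⟨h₁, h₂, h₃⟩ := cliques (Fin 3) (Fin 3) 0 1 0 1 (by simp) (by simp) (by simp) (by simp)
    exact ⟨_, _, _, _, h₁, (h₃ _ (.inl rfl)).1, h₂, (h₃ _ (.inl rfl)).2⟩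
  -- Here `ℓ = k + 4`, and `ℓ - 1` reduces to `k + 3`.
  · obtain ⟨k, rfl⟩ := Nat.exists_eq_add_of_le' (Nat.succ_le_of_lt hℓ)
    exact ⟨_, _, _, _, DominationGame.graphY_connected, hY k,
      DominationGame.gameDominationNumber_graphY,
      DominationGame.gameDominationNumber_graphY_deleteEdges⟩
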